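/- A \emph{continuum} is a nondegenerate (i.e. having more than one point) compact connected metric space. For a continuum $X$, let $C(X)$ be the hyperspace of all nonempty closed connected subsets of $X$ (singletons included) with the Hausdorff metric. For $p\in X$, let $C(p,X)=\{A\in C(X): p\in A\}$ and let $HS(p,X)=C(X)/C(p,X)$ be the quotient space obtained from $C(X)$ by shrinking $C(p,X)$ to a point, with the quotient topology. The \emph{Cantor fan} is the cone $(K\times[0,1])/(K\times\{1\})$ over the Cantor set $K$, and a space is \emph{uniformly pathwise connected} if it is a continuous image of the Cantor fan. \textbf{Theorem.} For every continuum $X$ and every $p\in X$, the space $HS(p,X)$ is uniformly pathwise connected; that is, there is a continuous surjection from the Cantor fan onto $HS(p,X)$. -/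

import Mathlib

namespace ContinuumHyperspace

/-- The equivalence relation on `Z` whose only possibly nontrivial class is `A`. -/
def collapseSetoid {Z : Type*} (A : Set Z) : Setoid Z where
  r x y := x = y ∨ (x ∈ A ∧ y ∈ A)
  iseqv :=
    { refl := fun _ => Or.inl rfl
      symm := by
        rintro x y (h | h)
        · exact Or.inl h.symm
        · exact Or.inr h.symm
      trans := by
        rintro x y z (rfl | h) (rfl | k)
        · exact Or.inl rfl
        · exact Or.inr k
        · exact Or.inr h
        · exact Or.inr ⟨h.1, k.2⟩ }

/-- The quotient space `Z / A`, obtained from `Z` by shrinking the (nonempty) set `A` to a point. -/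
def Collapse {Z : Type*} (A : Set Z) : Type _ := Quotient (collapseSetoid A)

/-- `Z / A` carries the quotient topology. -/
instance {Z : Type*} [TopologicalSpace Z] (A : Set Z) : TopologicalSpace (Collapse A) :=
  inferInstanceAs (TopologicalSpace (Quotient (collapseSetoid A)))

/-- The cone over `Z`: the quotient space `(Z × [0,1]) / (Z × {1})`. -/
abbrev Cone (Z : Type*) [TopologicalSpace Z] : Type _ :=
  Collapse {q : Z × unitInterval | q.2 = 1}

/-- The Cantor fan: the cone over the (ternary) Cantor set. -/
abbrev CantorFan : Type := Cone cantorSet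

/-- A space is uniformly pathwise connected if it is a continuous image of the Cantor fan. -/
def UniformlyPathwiseConnected (Y : Type*) [TopologicalSpace Y] : Prop :=
  ∃ f : CantorFan → Y, Continuous f ∧ Function.Surjective f

/-- The hyperspace `C(X)` of subcontinua of `X` (nonempty compact connected subsets; singletons
are included), with the Hausdorff metric inherited from `NonemptyCompacts X`. -/
abbrev C (X : Type*) [MetricSpace X] : Type _ :=
  {A : TopologicalSpace.NonemptyCompacts X // IsConnected (A : Set X)}

/-- `C(p, X)`: the set of those members of `C(X)` that contain the point `p`. -/
def Cpoint {X : Type*} [MetricSpace X] (p : X) : Set (C X) :=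
  {A | p ∈ A.1}

/-- The hyperspace `HS(p, X) = C(X) / C(p, X)`, with the quotient topology. -/
abbrev HS {X : Type*} [MetricSpace X] (p : X) : Type _ :=
  Collapse (Cpoint p)

end ContinuumHyperspace

open Set Filter Topology TopologicalSpace Metric

namespace ContinuumHyperspace

/-! ### General topology: closed graphs, limits of connected sets, boundary bumping. -/

section General

variable {Y Z : Type*} [TopologicalSpace Y] [TopologicalSpace Z]

/-! Since `HS p` is a quotient of `C X`, it suffices to map the Cantor fan onto `C X`. Every
subcontinuum `A` grows to `X` along a chain without size gaps: take a maximal chain through `A` and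
`X`; boundary bumping would insert a member into any gap. The pairs of `A` with such a chain form a
compact metric space `orderArcs X`, so the Cantor set maps onto it. Parametrizing all the chains by
one strictly monotone size makes the motion jointly continuous; it starts at `A` and always ends at
`X`, so it descends to the cone. -/

/-- A map into a compact space with closed graph is continuous. -/
theorem continuous_of_isClosed_graph_of_compactSpace [CompactSpace Z] {f : Y → Z}
    (hf : IsClosed {q : Y × Z | q.2 = f q.1}) : Continuous f := by
  refine continuous_iff_isClosed.2 fun E hE => ?_
  convert isClosedMap_fst_of_compactSpace _ (hf.inter (hE.preimage continuous_snd)) using 1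
  ext y
  constructor
  · exact fun hy => ⟨(y, f y), ⟨rfl, hy⟩, rfl⟩
  · rintro ⟨⟨y, z⟩, ⟨hz, hE⟩, rfl⟩
    have hz : z = f y := hz
    subst hz
    exact hE

/-- The connected members of the hyperspace of nonempty compact sets form a closed set. -/
theorem isClosed_setOf_isConnected [T2Space Y] :
    IsClosed {K : NonemptyCompacts Y | IsConnected (K : Set Y)} := by
  rw [← isOpen_compl_iff, isOpen_iff_mem_nhds]
  intro K hK
  have hK' : ¬ IsPreconnected (K : Set Y) := fun h => hK ⟨K.nonempty, h⟩
  rw [isPreconnected_closed_iff] at hK'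
  push Not at hK'
  obtain ⟨t, t', ht, ht', hsub, ⟨x, hxK, hxt⟩, ⟨y, hyK, hyt⟩, hdisj⟩ := hK'
  have hd : Disjoint ((K : Set Y) ∩ t) ((K : Set Y) ∩ t') := by
    rw [Set.disjoint_left]
    rintro z ⟨hz, hzt⟩ ⟨-, hzt'⟩
    exact (hdisj ▸ (⟨hz, hzt, hzt'⟩ : z ∈ (K : Set Y) ∩ (t ∩ t')) : z ∈ (∅ : Set Y))
  obtain ⟨U, V, hU, hV, hKU, hKV, hUV⟩ :=
    SeparatedNhds.of_isCompact_isCompact (K.isCompact.inter_right ht) (K.isCompact.inter_right ht') hd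
  filter_upwards [(NonemptyCompacts.isOpen_subsets_of_isOpen (hU.union hV)).mem_nhds
      (show (K : Set Y) ⊆ U ∪ V from fun z hz =>
        (hsub hz).imp (fun h => hKU ⟨hz, h⟩) fun h => hKV ⟨hz, h⟩),
    (NonemptyCompacts.isOpen_inter_nonempty_of_isOpen hU).mem_nhds ⟨x, hxK, hKU ⟨hxK, hxt⟩⟩,
    (NonemptyCompacts.isOpen_inter_nonempty_of_isOpen hV).mem_nhds ⟨y, hyK, hKV ⟨hyK, hyt⟩⟩]
    with L h1 h2 h3 hL
  obtain ⟨z, -, hzU, hzV⟩ := hL.2 U V hU hV h1 h2 h3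
  exact Set.disjoint_left.1 hUV hzU hzV

/-- Boundary bumping: a proper subcontinuum `B` of a continuum `K` is properly contained in a
connected compact subset of any closed neighbourhood of `B` in `K`. -/
theorem exists_connected_superset_of_subset_isOpen [T2Space Y] {B K F V : Set Y}
    (hB : IsConnected B) (hK : IsPreconnected K) (hKc : IsCompact K) (hBK : B ⊆ K) (hne : B ≠ K)
    (hF : IsClosed F) (hV : IsOpen V) (hBV : B ⊆ V) (hVF : V ⊆ F) :
    ∃ L, IsCompact L ∧ IsConnected L ∧ B ⊂ L ∧ L ⊆ K ∩ F := by
  obtain ⟨b, hb⟩ := hB.nonempty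
  have hZc : IsCompact (K ∩ F) := hKc.inter_right hF
  have hBZ : B ⊆ K ∩ F := fun x hx => ⟨hBK hx, hVF (hBV hx)⟩
  have hbZ := hBZ hb
  have : CompactSpace ↥(K ∩ F) := isCompact_iff_compactSpace.1 hZc
  refine ⟨connectedComponentIn (K ∩ F) b, ?_, isConnected_connectedComponentIn_iff.2 hbZ,
    ⟨hB.isPreconnected.subset_connectedComponentIn hb hBZ, fun hsub => ?_⟩,
    connectedComponentIn_subset _ _⟩
  · rw [connectedComponentIn_eq_image hbZ]
    exact isClosed_connectedComponent.isCompact.image continuous_subtype_val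
  -- If the component were inside `B`, then, being an intersection of clopen sets, it would give by
  -- compactness a clopen `Q ⊆ V`. Such a `Q` is also relatively clopen in `K`, hence separates it.
  · rw [connectedComponentIn_eq_image hbZ, connectedComponent_eq_iInter_isClopen] at hsub
    have hW : IsOpen (Subtype.val ⁻¹' V : Set ↥(K ∩ F)) := hV.preimage continuous_subtype_val
    have : Nonempty {s : Set ↥(K ∩ F) // IsClopen s ∧ ⟨b, hbZ⟩ ∈ s} :=
      ⟨⟨univ, isClopen_univ, mem_univ _⟩⟩
    obtain ⟨⟨Q, hQ, hbQ⟩, hQV⟩ := exists_subset_nhds_of_compactSpace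
      (V := fun s : {s : Set ↥(K ∩ F) // IsClopen s ∧ ⟨b, hbZ⟩ ∈ s} => (s : Set ↥(K ∩ F)))
      (fun s t => ⟨⟨s.1 ∩ t.1, s.2.1.inter t.2.1, s.2.2, t.2.2⟩, inter_subset_left,
        inter_subset_right⟩) (fun s => s.2.1.isClosed)
      (fun x hx => hW.mem_nhds (hBV (hsub ⟨x, hx, rfl⟩)))
    obtain ⟨U, hU, rfl⟩ := isOpen_induced_iff.1 hQ.isOpen
    have hQc : IsClosed (Subtype.val '' (Subtype.val ⁻¹' U : Set ↥(K ∩ F))) :=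
      (hQ.isClosed.isCompact.image continuous_subtype_val).isClosed
    obtain ⟨k, hkK, hkU⟩ : ∃ k ∈ K, k ∉ U ∩ V := by
      by_contra! hall
      refine hne (hBK.antisymm fun k hk => ?_)
      have hKF : K ⊆ K ∩ F := fun z hz => ⟨hz, hVF (hall z hz).2⟩
      refine hsub ⟨⟨k, hKF hk⟩, ?_, rfl⟩
      rw [← connectedComponent_eq_iInter_isClopen]
      have := (hK.subset_connectedComponentIn (hBK hb) hKF) hk
      rw [connectedComponentIn_eq_image hbZ] at this
      obtain ⟨z, hz, rfl⟩ := this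
      exact hz
    obtain ⟨z, hzK, ⟨w, hwU, rfl⟩, hzU⟩ := isPreconnected_closed_iff.1 hK _ _ hQc
      (hU.inter hV).isClosed_compl
      (fun z hz => by
        by_cases h : z ∈ U ∩ V
        · exact Or.inl ⟨⟨z, hz, hVF h.2⟩, h.1, rfl⟩
        · exact Or.inr h)
      ⟨b, hBK hb, ⟨⟨b, hbZ⟩, hbQ, rfl⟩⟩ ⟨k, hkK, hkU⟩
    exact hzU ⟨hwU, hQV hwU⟩

end General

/-! ### Chains of subcontinua. -/

section Whitney

variable {X : Type*} [MetricSpace X]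

/-- Between two comparable distinct subcontinua there is a third one. -/
theorem exists_lt_lt_of_lt {A B : C X} (h : A < B) : ∃ L : C X, A < L ∧ L < B := by
  obtain ⟨b, hbB, hbA⟩ : ∃ b ∈ (B.1 : Set X), b ∉ (A.1 : Set X) := Set.not_subset.1 h.not_ge
  obtain ⟨U, V, hU, hV, hAU, hbV, hUV⟩ := SeparatedNhds.of_isCompact_isCompact
    A.1.isCompact (isCompact_singleton (x := b)) (Set.disjoint_singleton_right.2 hbA)
  obtain ⟨L, hLc, hL, hAL, hLB⟩ := exists_connected_superset_of_subset_isOpen A.2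
    B.2.isPreconnected B.1.isCompact h.le (fun e => hbA (e ▸ hbB)) hV.isClosed_compl hU hAU
    (Set.disjoint_left.1 hUV)
  refine ⟨⟨⟨⟨L, hLc⟩, hL.nonempty⟩, hL⟩, ?_, ?_⟩
  · exact ⟨hAL.1, hAL.2⟩
  · exact ⟨fun x hx => (hLB hx).1, fun hBL => (hLB (hBL hbB)).2 (hbV rfl)⟩

theorem isClosed_setOf_le : IsClosed {q : C X × C X | q.1 ≤ q.2} := by
  have : {q : C X × C X | q.1 ≤ q.2} = {q | q.1.1 ⊔ q.2.1 = q.2.1} := by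
    ext q
    exact (sup_eq_right (a := q.1.1) (b := q.2.1)).symm
  rw [this]
  exact isClosed_eq (by fun_prop) (by fun_prop)

/-- A maximal chain of subcontinua is closed. -/
theorem isClosed_flag (s : Flag (C X)) : IsClosed (s : Set (C X)) := by
  have hle : ∀ A : C X, IsClosed {B : C X | A ≤ B ∨ B ≤ A} := fun A =>
    (isClosed_setOf_le.preimage (by fun_prop : Continuous fun B : C X => (A, B))).union
      (isClosed_setOf_le.preimage (by fun_prop : Continuous fun B : C X => (B, A)))
  refine isClosed_of_closure_subset fun A hA => ?_
  -- Comparability with a fixed member is a closed condition, so it passes to limits of the chain.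
  have hchain : IsChain (· ≤ ·) (insert A (s : Set (C X))) :=
    s.chain_le.insert fun B hB _ =>
      (closure_minimal (fun E hE => s.le_or_le hB hE) (hle B) hA).symm
  rw [s.maxChain.2 hchain (subset_insert _ _)]
  exact mem_insert _ _

theorem isClosed_setOf_mem {Y : Type*} [MetricSpace Y] :
    IsClosed {q : Y × NonemptyCompacts Y | q.1 ∈ q.2} := by
  have : {q : Y × NonemptyCompacts Y | q.1 ∈ q.2} = {q | infDist q.1 (q.2 : Set Y) = 0} := by
    ext q
    exact q.2.isCompact.isClosed.mem_iff_infDist_zero q.2.nonempty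
  rw [this]
  exact isClosed_eq lipschitz_infDist.continuous continuous_const

theorem isClosed_setOf_isChain :
    IsClosed {K : NonemptyCompacts (C X) | IsChain (· ≤ ·) (K : Set (C X))} := by
  have hle : IsClosed {q : C X × C X | q.1 ≤ q.2 ∨ q.2 ≤ q.1} :=
    isClosed_setOf_le.union (isClosed_setOf_le.preimage continuous_swap)
  convert (NonemptyCompacts.isClosed_subsets_of_isClosed hle).preimage
    (by fun_prop : Continuous fun K : NonemptyCompacts (C X) => K ×ˢ K) using 1
  ext K
  constructor
  · rintro hK ⟨A, B⟩ ⟨hA, hB⟩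
    exact hK.total hA hB
  · intro hK A hA B hB _
    exact hK (show (A, B) ∈ (K : Set (C X)) ×ˢ (K : Set (C X)) from ⟨hA, hB⟩)

variable [CompactSpace X]

instance : CompactSpace (C X) :=
  isCompact_iff_compactSpace.1 isClosed_setOf_isConnected.isCompact

theorem infDist_le_diam (x : X) (A : C X) : infDist x (A.1 : Set X) ≤ diam (univ : Set X) := by
  obtain ⟨a, ha⟩ := A.1.nonempty
  exact (infDist_le_dist_of_mem ha).trans
    (dist_le_diam_of_mem isCompact_univ.isBounded (mem_univ _) (mem_univ _))

theorem summable_diam (X : Type*) [MetricSpace X] :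
    Summable fun n : ℕ => (1 / 2 : ℝ) ^ n * diam (univ : Set X) :=
  summable_geometric_two.mul_right _

variable [Nonempty X]

/-- A strictly antitone continuous size function on the hyperspace of subcontinua. -/
noncomputable def cosize (A : C X) : ℝ :=
  ∑' n : ℕ, (1 / 2 : ℝ) ^ n * infDist (denseSeq X n) (A.1 : Set X)

theorem cosize_term_le (A : C X) (n : ℕ) :
    (1 / 2 : ℝ) ^ n * infDist (denseSeq X n) (A.1 : Set X) ≤
      (1 / 2 : ℝ) ^ n * diam (univ : Set X) :=
  mul_le_mul_of_nonneg_left (infDist_le_diam _ A) (by positivity)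

theorem cosize_term_nonneg (A : C X) (n : ℕ) :
    0 ≤ (1 / 2 : ℝ) ^ n * infDist (denseSeq X n) (A.1 : Set X) :=
  mul_nonneg (by positivity) infDist_nonneg

theorem summable_cosize (A : C X) :
    Summable fun n : ℕ => (1 / 2 : ℝ) ^ n * infDist (denseSeq X n) (A.1 : Set X) :=
  (summable_diam X).of_nonneg_of_le (cosize_term_nonneg A) (cosize_term_le A)

theorem cosize_nonneg (A : C X) : 0 ≤ cosize A := tsum_nonneg (cosize_term_nonneg A)

theorem continuous_cosize : Continuous (cosize : C X → ℝ) := by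
  refine continuous_tsum (fun n => ?_) (summable_diam X) fun n A => ?_
  · exact continuous_const.mul ((lipschitz_infDist_set _).continuous.comp continuous_subtype_val)
  · rw [Real.norm_of_nonneg (cosize_term_nonneg A n)]
    exact cosize_term_le A n

/-- A dense-sequence point close enough to some `b ∈ B \ A` is nearer to `B` than to `A`, so its
term drops strictly. -/
theorem cosize_strictAnti : StrictAnti (cosize : C X → ℝ) := by
  intro A B h
  obtain ⟨b, hbB, hbA⟩ : ∃ b ∈ (B.1 : Set X), b ∉ (A.1 : Set X) := Set.not_subset.1 h.not_ge
  have hpos := (A.1.isCompact.isClosed.notMem_iff_infDist_pos A.1.nonempty).1 hbA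
  obtain ⟨n, hn⟩ := (denseRange_denseSeq X).exists_dist_lt b (half_pos hpos)
  refine Summable.tsum_lt_tsum (i := n) (fun m => ?_) ?_ (summable_cosize B) (summable_cosize A)
  · exact mul_le_mul_of_nonneg_left (infDist_le_infDist_of_subset h.le A.1.nonempty)
      (by positivity)
  · refine mul_lt_mul_of_pos_left ?_ (by positivity)
    have h1 : infDist (denseSeq X n) (B.1 : Set X) ≤ dist (denseSeq X n) b :=
      infDist_le_dist_of_mem hbB
    have h2 : infDist b (A.1 : Set X) ≤ infDist (denseSeq X n) (A.1 : Set X) +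
      dist b (denseSeq X n) := infDist_le_infDist_add_dist
    rw [dist_comm] at h1
    linarith

variable (X) in
/-- An upper bound of `cosize`. -/
noncomputable def cosizeBound : ℝ := ∑' n : ℕ, (1 / 2 : ℝ) ^ n * diam (univ : Set X)

theorem cosize_le_bound (A : C X) : cosize A ≤ cosizeBound X :=
  (summable_cosize A).tsum_le_tsum (cosize_term_le A) (summable_diam X)

theorem le_of_cosize_le {A B : C X} (h : A ≤ B ∨ B ≤ A) (hc : cosize A ≤ cosize B) : B ≤ A := by
  rcases h with h | h
  · rcases h.eq_or_lt with rfl | h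
    · exact le_rfl
    · exact absurd (cosize_strictAnti h) hc.not_gt
  · exact h

/-- A maximal chain of subcontinua attains every size between the sizes of two of its members. -/
theorem exists_mem_flag_cosize_eq (s : Flag (C X)) {A B : C X} (hA : A ∈ s) (hB : B ∈ s) {r : ℝ}
    (hr : r ∈ Icc (cosize B) (cosize A)) : ∃ L ∈ s, cosize L = r := by
  by_contra! hno
  have hs : IsCompact (s : Set (C X)) := (isClosed_flag s).isCompact
  -- `P` and `Q` are the two ends of the gap around `r`; a subcontinuum strictly between them would
  -- extend the maximal chain.
  obtain ⟨P, ⟨hPs, hPr⟩, hP⟩ := (hs.inter_right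
    (isClosed_le continuous_const continuous_cosize : IsClosed {E : C X | r ≤ cosize E})
    ).exists_isMinOn ⟨A, hA, hr.2⟩ continuous_cosize.continuousOn
  obtain ⟨Q, ⟨hQs, hQr⟩, hQ⟩ := (hs.inter_right
    (isClosed_le continuous_cosize continuous_const : IsClosed {E : C X | cosize E ≤ r})
    ).exists_isMaxOn ⟨B, hB, hr.1⟩ continuous_cosize.continuousOn
  have hPr : r < cosize P := lt_of_le_of_ne hPr (hno P hPs).symm
  have hQr : cosize Q < r := lt_of_le_of_ne hQr (hno Q hQs)
  have key : ∀ E ∈ s, E ≤ P ∨ Q ≤ E := by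
    intro E hE
    rcases le_total r (cosize E) with h | h
    · exact Or.inl (le_of_cosize_le (s.le_or_le hPs hE) (hP ⟨hE, h⟩))
    · exact Or.inr (le_of_cosize_le (s.le_or_le hE hQs) (hQ ⟨hE, h⟩))
  have hPQ : P < Q := (le_of_cosize_le (s.le_or_le hQs hPs) (hQr.trans hPr).le).lt_of_ne fun h => by
    rw [h] at hPr
    exact hPr.not_gt hQr
  obtain ⟨L, hPL, hLQ⟩ := exists_lt_lt_of_lt hPQ
  have hLs : L ∈ s := by
    have hchain : IsChain (· ≤ ·) (insert L (s : Set (C X))) :=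
      s.chain_le.insert fun E hE _ => (key E hE).symm.imp hLQ.le.trans fun h => h.trans hPL.le
    have := s.maxChain.2 hchain (subset_insert _ _)
    exact (this ▸ mem_insert L (s : Set (C X)) : L ∈ (s : Set (C X)))
  rcases le_total r (cosize L) with h | h
  · exact (cosize_strictAnti hPL).not_ge (hP ⟨hLs, h⟩)
  · exact (cosize_strictAnti hLQ).not_ge (hQ ⟨hLs, h⟩)

/-! ### The space of order arcs and its parametrization. -/

variable (X) in
/-- Pairs of a subcontinuum `A` and a compact chain of subcontinua that contains `A` and attains
every size between that of `A` and that of the whole space. -/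
def orderArcs : Set (C X × NonemptyCompacts (C X)) :=
  {q | q.1 ∈ q.2 ∧ IsChain (· ≤ ·) (q.2 : Set (C X)) ∧
    ∀ t : unitInterval, ∃ B ∈ q.2, cosize B = min (cosize q.1) (cosizeBound X * (1 - t))}

theorem isClosed_orderArcs : IsClosed (orderArcs X) := by
  refine isClosed_setOf_mem.inter ((isClosed_setOf_isChain.preimage continuous_snd).inter ?_)
  have hInter : {q : C X × NonemptyCompacts (C X) | ∀ t : unitInterval,
      ∃ B ∈ q.2, cosize B = min (cosize q.1) (cosizeBound X * (1 - t))} =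
      ⋂ t : unitInterval, {q | ∃ B ∈ q.2,
        cosize B = min (cosize q.1) (cosizeBound X * (1 - t))} := by
    ext q
    simp
  change IsClosed {q : C X × NonemptyCompacts (C X) | ∀ t : unitInterval,
    ∃ B ∈ q.2, cosize B = min (cosize q.1) (cosizeBound X * (1 - t))}
  rw [hInter]
  refine isClosed_iInter fun t => ?_
  have hc := continuous_cosize (X := X)
  -- The existential over `B` is a projection along the compact space `C X`.
  convert isClosedMap_fst_of_compactSpace _
    ((isClosed_setOf_mem.preimage (by fun_prop : Continuous
      fun z : (C X × NonemptyCompacts (C X)) × C X => (z.2, z.1.2))).inter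
    (isClosed_eq (by fun_prop : Continuous
      fun z : (C X × NonemptyCompacts (C X)) × C X => cosize z.2)
      (by fun_prop : Continuous fun z : (C X × NonemptyCompacts (C X)) × C X =>
        min (cosize z.1.1) (cosizeBound X * (1 - t))))) using 1
  ext q
  constructor
  · rintro ⟨B, hB, hBt⟩
    exact ⟨(q, B), ⟨hB, hBt⟩, rfl⟩
  · rintro ⟨⟨q, B⟩, ⟨hB, hBt⟩, rfl⟩
    exact ⟨B, hB, hBt⟩

/-- The point at time `t` of an order arc, parametrized by size. -/
noncomputable def arcPoint (z : orderArcs X × unitInterval) : C X :=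
  (z.1.2.2.2 z.2).choose

theorem arcPoint_mem (z : orderArcs X × unitInterval) : arcPoint z ∈ z.1.1.2 :=
  (z.1.2.2.2 z.2).choose_spec.1

theorem cosize_arcPoint (z : orderArcs X × unitInterval) :
    cosize (arcPoint z) = min (cosize z.1.1.1) (cosizeBound X * (1 - z.2)) :=
  (z.1.2.2.2 z.2).choose_spec.2

theorem eq_of_cosize_eq {A B : C X} (h : A ≤ B ∨ B ≤ A) (hc : cosize A = cosize B) : A = B :=
  le_antisymm (le_of_cosize_le h.symm hc.ge) (le_of_cosize_le h hc.le)

theorem eq_arcPoint_iff (z : orderArcs X × unitInterval) (B : C X) :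
    B = arcPoint z ↔
      B ∈ z.1.1.2 ∧ cosize B = min (cosize z.1.1.1) (cosizeBound X * (1 - z.2)) := by
  refine ⟨?_, fun h => eq_of_cosize_eq (z.1.2.2.1.total h.1 (arcPoint_mem z))
    (h.2.trans (cosize_arcPoint z).symm)⟩
  rintro rfl
  exact ⟨arcPoint_mem z, cosize_arcPoint z⟩

/-- Size determines a member of a chain, so the graph is cut out by two closed conditions, whatever
`choose` picks. -/
theorem continuous_arcPoint : Continuous (arcPoint : orderArcs X × unitInterval → C X) := by
  refine continuous_of_isClosed_graph_of_compactSpace ?_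
  simp only [eq_arcPoint_iff]
  have hc := continuous_cosize (X := X)
  exact (isClosed_setOf_mem.preimage (by fun_prop : Continuous
      fun w : (orderArcs X × unitInterval) × C X => (w.2, w.1.1.1.2))).inter
    (isClosed_eq (by fun_prop) (by fun_prop))

theorem arcPoint_zero (a : orderArcs X) : arcPoint (a, 0) = a.1.1 := by
  refine ((eq_arcPoint_iff _ _).2 ⟨a.2.1, ?_⟩).symm
  simp [cosize_le_bound]

variable [ConnectedSpace X]

variable (X) in
/-- The whole space as a point of the hyperspace of its subcontinua. -/
def wholeSpace : C X := ⟨⊤, isConnected_univ⟩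

theorem le_wholeSpace (A : C X) : A ≤ wholeSpace X := fun _ _ => mem_univ _

theorem cosize_wholeSpace : cosize (wholeSpace X) = 0 := by
  have h : ∀ x : X, infDist x ((wholeSpace X).1 : Set X) = 0 := fun x =>
    infDist_zero_of_mem (mem_univ x)
  simp [cosize, h]

/-- The common endpoint is what lets the map factor through the cone. -/
theorem arcPoint_one (a : orderArcs X) : arcPoint (a, 1) = wholeSpace X := by
  refine eq_of_cosize_eq (Or.inl (le_wholeSpace _)) ?_
  rw [cosize_arcPoint, cosize_wholeSpace]
  simp [cosize_nonneg]

theorem exists_orderArc (A : C X) : ∃ a : orderArcs X, a.1.1 = A := by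
  obtain ⟨s, hA, hW⟩ := Flag.exists_mem_mem (le_wholeSpace A)
  refine ⟨⟨(A, ⟨⟨s, (isClosed_flag s).isCompact⟩, A, hA⟩), hA, s.chain_le, fun t => ?_⟩, rfl⟩
  refine exists_mem_flag_cosize_eq s hA hW ⟨?_, min_le_left _ _⟩
  rw [cosize_wholeSpace]
  exact le_min (cosize_nonneg A) (mul_nonneg ((cosize_nonneg A).trans (cosize_le_bound A))
    (sub_nonneg.2 t.2.2))

variable (X) in
/-- The hyperspace of subcontinua is a continuous image of the Cantor fan. -/
theorem uniformlyPathwiseConnected_hyperspace : UniformlyPathwiseConnected (C X) := by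
  have : CompactSpace (orderArcs X) := isCompact_iff_compactSpace.1 isClosed_orderArcs.isCompact
  have : Nonempty (orderArcs X) := ⟨(exists_orderArc (wholeSpace X)).choose⟩
  obtain ⟨g, hg, hgs⟩ := exists_nat_bool_continuous_surjective_of_compact (orderArcs X)
  refine ⟨Quotient.lift
    (fun q : cantorSet × unitInterval => arcPoint (g (cantorSetHomeomorphNatToBool q.1), q.2)) ?_,
    Continuous.quotient_lift (continuous_arcPoint.comp (by fun_prop)) _, fun A => ?_⟩
  · rintro ⟨x, t⟩ ⟨y, u⟩ (h | ⟨h1, h2⟩)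
    · rw [h]
    · obtain rfl : t = 1 := h1
      obtain rfl : u = 1 := h2
      simp only [arcPoint_one]
  · obtain ⟨a, rfl⟩ := exists_orderArc A
    obtain ⟨w, rfl⟩ := hgs a
    refine ⟨Quotient.mk _ (cantorSetHomeomorphNatToBool.symm w, 0), ?_⟩
    simp [arcPoint_zero]

end Whitney

end ContinuumHyperspace

theorem mainTheorem12 {X : Type*} [MetricSpace X] [CompactSpace X] [ConnectedSpace X]
    [Nontrivial X] (p : X) :
    ContinuumHyperspace.UniformlyPathwiseConnected (ContinuumHyperspace.HS p) := by
  obtain ⟨f, hf, hfs⟩ := ContinuumHyperspace.uniformlyPathwiseConnected_hyperspace X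
  exact ⟨_, continuous_quotient_mk'.comp hf, Quotient.mk_surjective.comp hfs⟩
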